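/- For a category $\mathcal{C}$ and a class $W$ of maps of $\mathcal{C}$, let $\mathrm{inj}_{\mathcal{C}}(W)$ be the class of maps of $\mathcal{C}$ that have the right lifting property with respect to every map of $W$, and let $\mathrm{cof}_{\mathcal{C}}(W)$ be the class of maps of $\mathcal{C}$ that have the left lifting property with respect to every map of $\mathrm{inj}_{\mathcal{C}}(W)$. An object $X$ of $\mathcal{C}$ is injective with respect to a cone of maps $(A\to A_i)_{i\in S}$ (where $S$ is a set, possibly empty) if every map $A\to X$ factors through $A\to A_i$ for some $i\in S$. A small cone-injectivity class of $\mathcal{C}$ is the full subcategory of the objects that are injective with respect to all cones of a given set of cones. **Theorem.** Let $\mathcal{K}$ be a locally presentable category and let $I$ be a set of maps of $\mathcal{K}$. Let $\mathcal{A}\subset\mathcal{K}$ be the small cone-injectivity class given by a set of cones such that every map of every cone belongs to $\mathrm{cof}_{\mathcal{K}}(I)$. Suppose that $\mathcal{A}$ is coreflective, i.e. that the inclusion functor $\mathcal{A}\subset\mathcal{K}$ has a right adjoint. Then there exists a set $J$ of maps of $\mathcal{A}$ such that $$\mathrm{cof}_{\mathcal{K}}(I)\cap\mathrm{Mor}(\mathcal{A})=\mathrm{cof}_{\mathcal{A}}(J),$$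 and $(\mathrm{cof}_{\mathcal{A}}(J),\mathrm{inj}_{\mathcal{A}}(J))$ is a weak factorization system on $\mathcal{A}$: each of the two classes is determined by the other through the lifting property, and every map of $\mathcal{A}$ factors as a map of $\mathrm{cof}_{\mathcal{A}}(J)$ followed by a map of $\mathrm{inj}_{\mathcal{A}}(J)$. In other words, the small weak factorization system $(\mathrm{cof}_{\mathcal{K}}(I),\mathrm{inj}_{\mathcal{K}}(I))$ restricts to a small one on $\mathcal{A}$. -/

import Mathlib

open CategoryTheory Limits

universe w v u

/-- A `w`-small cone of maps `(A ⟶ A i)` in a category: a set-indexed (possibly empty) family of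
maps with common source. -/
structure ConeOfMaps (K : Type u) [Category.{v} K] where
  /-- the index set of the cone -/
  ι : Type w
  /-- the common source of the maps -/
  source : K
  /-- the targets of the maps -/
  target : ι → K
  /-- the maps of the cone -/
  map : ∀ i : ι, source ⟶ target i

/-- An object `X` is injective with respect to a cone `(A ⟶ A i)` if every map `A ⟶ X` factors
through some member `A ⟶ A i` of the cone (which one may depend on the map). -/
def ConeOfMaps.IsInjective {K : Type u} [Category.{v} K] (c : ConeOfMaps.{w} K) (X : K) : Prop :=
  ∀ f : c.source ⟶ X, ∃ (i : c.ι) (g : c.target i ⟶ X), c.map i ≫ g = f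

/-- The objects that are injective with respect to every cone of a family of cones. For a
`w`-small family (`σ : Type w`) this is a small cone-injectivity class. -/
def coneInjectives {K : Type u} [Category.{v} K] {σ : Type w} (c : σ → ConeOfMaps.{w} K) :
    ObjectProperty K :=
  fun X => ∀ s : σ, (c s).IsInjective X

/-- The class `inj_K(W)` of the maps with the right lifting property with respect to `W`. -/
abbrev injMaps {K : Type u} [Category.{v} K] (W : MorphismProperty K) : MorphismProperty K :=
  W.rlp

/-- The class `cof_K(W)` of the maps with the left lifting property with respect to every map of
`inj_K(W)`. -/
abbrev cofMaps {K : Type u} [Category.{v} K] (W : MorphismProperty K) : MorphismProperty K :=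
  (injMaps W).llp

/-! ### Presentability and the small object argument. -/

namespace CategoryTheory

/-! The key is that inj_A(J) lies in inj_K(I), where J represents the maps of cof_K(I) between
objects of A of bounded size. Given a square from f : X₀ ⟶ Y₀ in I to p : X ⟶ Y in A, factor X₀ ⟶ X
through a bounded X' in A, then factor Y₀ ⊔_{X₀} X' ⟶ Y through a bounded Y' in A, starting with a
map of cof_K(I). Then X' ⟶ Y' is in cof_K(I), and lifting it against p solves the problem
(`rlp_map_ι_of_factorization`).

The factorizations (`exists_essentiallySmall_factorization`) come from a small object argument over
the target: its injectivity selects the cone members to attach, and the size bound does not depend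
on it. Coreflectivity makes A cocomplete with presentable objects, so the small object argument
applies to J; transposing squares along the adjunction gives cof_A(J) ⊂ cof_K(I). -/

lemma exists_isCardinalPresentable_forall {ι : Type*} [Small.{w} ι]
    {C : Type*} [Category* C]
    (X : ι → C) [∀ i, IsPresentable.{w} (X i)] :
    ∃ (κ : Cardinal.{w}) (_ : Fact κ.IsRegular), ∀ i, IsCardinalPresentable (X i) κ := by
  choose κ hκ₀ hκ using fun i ↦ Functor.IsAccessible.exists_cardinal.{w}
    (F := coyoneda.obj (Opposite.op (X i)))
  obtain ⟨κ', hκ', h⟩ := HasCardinalLT.exists_regular_cardinal_forall.{w}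
    (fun i ↦ (κ i).ord.ToType)
  have : Fact κ'.IsRegular := ⟨hκ'⟩
  refine ⟨κ', this, fun i ↦ ?_⟩
  have : IsCardinalPresentable (X i) (κ i) := hκ i
  exact isCardinalPresentable_of_le (X i) (κ := κ i)
    (le_of_lt (by simpa [hasCardinalLT_iff_cardinal_mk_lt] using h i))

/-- The small object argument applies to small classes of maps with presentable sources. -/
lemma hasSmallObjectArgument_of_isPresentable {C : Type*} [Category* C] [LocallySmall.{w} C]
    [HasPushouts C] [HasColimitsOfSize.{w, w} C] (W : MorphismProperty C)
    [MorphismProperty.IsSmall.{w} W] [∀ X : C, IsPresentable.{w} X] :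
    MorphismProperty.HasSmallObjectArgument.{w} W := by
  obtain ⟨κ, hκ, h⟩ := exists_isCardinalPresentable_forall.{w} (fun g : W.toSet ↦ g.1.left)
  have : Nonempty κ.ord.ToType := by simpa using hκ.out.ne_zero
  let : OrderBot κ.ord.ToType := WellFoundedLT.toOrderBot κ.ord.ToType
  refine ⟨κ, hκ, inferInstance, { preservesColimit := fun {A _ _ _} i hi _ _ ↦ ?_ }⟩
  have : IsCardinalPresentable A κ := h ⟨Arrow.mk i, hi⟩
  have := preservesColimitsOfShape_of_isCardinalPresentable A κ κ.ord.ToType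
  infer_instance

/-- An object is presentable if its image under a fully faithful functor preserving colimits is. -/
lemma Functor.FullyFaithful.isPresentable {C D : Type*} [Category.{v} C] [Category.{v} D]
    {F : C ⥤ D} (hF : F.FullyFaithful) [PreservesColimitsOfSize.{w, w} F] (X : C)
    [IsPresentable.{w} (F.obj X)] : IsPresentable.{w} X := by
  obtain ⟨κ, hκ, _⟩ := Functor.IsAccessible.exists_cardinal.{w}
    (F := coyoneda.obj (Opposite.op (F.obj X)))
  -- Hom(X, -) ≅ Hom(F X, F -), and F preserves the colimits involved.
  have : IsCardinalPresentable X κ := Functor.isCardinalAccessible_of_natIso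
    (F := F ⋙ coyoneda.obj (Opposite.op (F.obj X))) (G := coyoneda.obj (Opposite.op X))
    (NatIso.ofComponents (fun Y ↦ (hF.homEquiv (X := X) (Y := Y)).symm.toIso) (fun g ↦ by
      ext k
      exact hF.map_injective (by simp))) κ
  exact isPresentable_of_isCardinalPresentable X κ

lemma Functor.FullyFaithful.hasLiftingProperty {C D : Type*} [Category* C] [Category* D]
    {F : C ⥤ D} (hF : F.FullyFaithful) {X Y X' Y' : C} (g : X ⟶ Y) (p : X' ⟶ Y')
    [HasLiftingProperty (F.map g) (F.map p)] : HasLiftingProperty g p where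
  sq_hasLift {t b} sq := by
    have sq' : CommSq (F.map t) (F.map g) (F.map p) (F.map b) := sq.map F
    exact ⟨⟨{
      l := hF.preimage sq'.lift
      fac_left := hF.map_injective (by simp)
      fac_right := hF.map_injective (by simp) }⟩⟩

end CategoryTheory

/-! ### Attaching cells, with size control. -/

namespace ConeOfMaps

variable {K : Type u} [Category.{v} K]

section Attach

variable [LocallySmall.{w} K] {σ : Type w} (c : σ → ConeOfMaps.{w} K)

/-- The `w`-small type of all maps from the sources of the cones of a family to an object. -/
def Cells (Y : K) : Type w := Σ s : σ, Shrink.{w} ((c s).source ⟶ Y)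

variable {c} in
/-- The attaching map of a cell. -/
noncomputable def Cells.hom {Y : K} (d : Cells c Y) : (c d.1).source ⟶ Y :=
  (equivShrink _).symm d.2

lemma Cells.exists_hom_eq {Y : K} (s : σ) (h : (c s).source ⟶ Y) :
    ∃ d : Shrink.{w} ((c s).source ⟶ Y), Cells.hom (c := c) ⟨s, d⟩ = h :=
  ⟨equivShrink _ h, by simp [Cells.hom]⟩

/-- Isomorphic objects have the same cells. -/
noncomputable def Cells.equivOfIso {Y Y' : K} (e : Y ≅ Y') : Cells c Y ≃ Cells c Y' :=
  Equiv.sigmaCongrRight fun _ ↦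
    ((equivShrink _).symm.trans ((Iso.refl _).homCongr e)).trans (equivShrink _)

variable [HasPushouts K] [HasCoproducts.{w} K]

variable {c}

/-- The object obtained by attaching to `Y`, for each map `d` from the source of a cone to `Y`, the
target of the member `i d` of this cone. -/
noncomputable def attach {Y : K} (i : ∀ d : Cells c Y, (c d.1).ι) : K :=
  pushout (Limits.Sigma.desc (fun d : Cells c Y ↦ d.hom))
    (Limits.Sigma.map (fun d : Cells c Y ↦ (c d.1).map (i d)))

/-- The inclusion of an object in the object obtained by attaching cells. -/
noncomputable def toAttach {Y : K} (i : ∀ d : Cells c Y, (c d.1).ι) : Y ⟶ attach i :=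
  pushout.inl _ _

lemma exists_map_comp_eq_hom_comp_toAttach {Y : K} (i : ∀ d : Cells c Y, (c d.1).ι)
    (d : Cells c Y) :
    ∃ g : (c d.1).target (i d) ⟶ attach i, (c d.1).map (i d) ≫ g = d.hom ≫ toAttach i := by
  refine ⟨Sigma.ι (fun d : Cells c Y ↦ (c d.1).target (i d)) d ≫ pushout.inr _ _, ?_⟩
  have := Sigma.ι (fun d : Cells c Y ↦ (c d.1).source) d ≫= pushout.condition
    (f := Limits.Sigma.desc (fun d : Cells c Y ↦ d.hom))
    (g := Limits.Sigma.map (fun d : Cells c Y ↦ (c d.1).map (i d)))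
  rw [Sigma.ι_desc_assoc, Limits.Sigma.ι_map_assoc] at this
  exact this.symm

lemma exists_toAttach_comp_eq {Y Z : K} (i : ∀ d : Cells c Y, (c d.1).ι) (y : Y ⟶ Z)
    (g : ∀ d : Cells c Y, (c d.1).target (i d) ⟶ Z)
    (hg : ∀ d, (c d.1).map (i d) ≫ g d = d.hom ≫ y) :
    ∃ z : attach i ⟶ Z, toAttach i ≫ z = y :=
  ⟨pushout.desc y (Limits.Sigma.desc g) (by ext d; simp [hg]), pushout.inl_desc _ _ _⟩

lemma llp_toAttach (T : MorphismProperty K) (hc : ∀ s i, T.llp ((c s).map i))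
    {Y : K} (i : ∀ d : Cells c Y, (c d.1).ι) : T.llp (toAttach i) := by
  refine MorphismProperty.of_isPushout (IsPushout.of_hasPushout
    (Limits.Sigma.desc (fun d : Cells c Y ↦ d.hom))
    (Limits.Sigma.map (fun d : Cells c Y ↦ (c d.1).map (i d)))) ?_
  intro A B p hp
  have := fun d : Cells c Y ↦ hc d.1 (i d) p hp
  infer_instance

/-- The sources and the targets of the maps of a family of cones. -/
def objects (c : σ → ConeOfMaps.{w} K) : ObjectProperty K :=
  .ofObj (fun s ↦ (c s).source) ⊔ .ofObj (fun p : Σ s, (c s).ι ↦ (c p.1).target p.2)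

instance : ObjectProperty.EssentiallySmall.{w} (objects c) := by
  dsimp [objects]
  infer_instance

lemma colimitsCardinalClosure_attach (P : ObjectProperty K) (κ : Cardinal.{w}) [Fact κ.IsRegular]
    {Y : K} (hY : P Y) (hκ : HasCardinalLT (Cells c Y) κ) (i : ∀ d : Cells c Y, (c d.1).ι) :
    (P ⊔ objects c).colimitsCardinalClosure κ (attach i) := by
  have hκ₀ := Cardinal.IsRegular.aleph0_le (Fact.out : κ.IsRegular)
  have := (P ⊔ objects c).isClosedUnderColimitsOfShape_colimitsCardinalClosure κ
    (Discrete (Cells c Y))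
    ((hasCardinalLT_iff_of_equiv (Arrow.discreteEquiv _).symm κ).1 hκ)
  have := (P ⊔ objects c).isClosedUnderColimitsOfShape_colimitsCardinalClosure κ
    WalkingSpan (hasCardinalLT_of_finite _ _ hκ₀)
  have h := (P ⊔ objects c).le_colimitsCardinalClosure κ
  refine ObjectProperty.prop_colimit _ _ ?_
  rintro (_ | _ | _)
  · exact ObjectProperty.prop_colimit _ _ fun d ↦ h _ (.inr (.inl ⟨_⟩))
  · exact h _ (.inl hY)
  · exact ObjectProperty.prop_colimit _ _
      fun d ↦ h _ (.inr (.inr ⟨(⟨d.as.1, i d.as⟩ : Σ s, (c s).ι)⟩))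

variable (c) in
-- The set of cells depends on `Y` only up to isomorphism, so one regular κ bounds it for all `Y` in
-- `P`; every `attach i` is then built by κ-small colimits from `P` and the objects of the cones.
lemma exists_essentiallySmall_attach (P : ObjectProperty K)
    [ObjectProperty.EssentiallySmall.{w} P] :
    ∃ Q : ObjectProperty K, ObjectProperty.EssentiallySmall.{w} Q ∧
      Q.IsClosedUnderIsomorphisms ∧
      ∀ (Y : K) (_ : P Y) (i : ∀ d : Cells c Y, (c d.1).ι), Q (attach i) := by
  obtain ⟨P', _, -, hP⟩ := ObjectProperty.EssentiallySmall.exists_small_le.{w} P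
  obtain ⟨κ, hκ, h⟩ := HasCardinalLT.exists_regular_cardinal_forall.{w}
    (fun Y : Subtype P' ↦ Cells c Y.1)
  have : Fact κ.IsRegular := ⟨hκ⟩
  refine ⟨(P ⊔ objects c).colimitsCardinalClosure κ, inferInstance, inferInstance,
    fun Y hY i ↦ ?_⟩
  obtain ⟨Y', hY', ⟨e⟩⟩ := hP _ hY
  exact colimitsCardinalClosure_attach P κ hY
    ((hasCardinalLT_iff_of_equiv (Cells.equivOfIso c e) κ).2 (h ⟨Y', hY'⟩)) i

end Attach

end ConeOfMaps

/-! ### Iterated attachment over a cone-injective object. -/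

namespace ConeOfMaps

open SmallObject

variable {K : Type u} [Category.{v} K] [LocallySmall.{w} K] [HasPushouts K]
  [HasColimitsOfSize.{w, w} K] {σ : Type w} {c : σ → ConeOfMaps.{w} K}

lemma exists_toAttach_comp_eq_of_coneInjectives {Z : K} (hZ : coneInjectives c Z) (Y : Over Z) :
    ∃ (i : ∀ d : Cells c Y.left, (c d.1).ι) (z : attach i ⟶ Z), toAttach i ≫ z = Y.hom := by
  choose i g h using fun d : Cells c Y.left ↦ hZ d.1 (d.hom ≫ Y.hom)
  exact ⟨i, exists_toAttach_comp_eq i _ g h⟩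

instance hasColimitsOfSize_over (Z : K) : HasColimitsOfSize.{w, w} (Over Z) where

/-- The successor structure on the objects over a cone-injective object `Z`, starting at `X`, which
attaches all possible cells compatibly with the maps to `Z`. -/
noncomputable def succStruct {Z : K} (hZ : coneInjectives c Z) (X : Over Z) :
    SuccStruct (Over Z) where
  X₀ := X
  succ Y := Over.mk (exists_toAttach_comp_eq_of_coneInjectives hZ Y).choose_spec.choose
  toSucc Y := Over.homMk (toAttach _)
    (exists_toAttach_comp_eq_of_coneInjectives hZ Y).choose_spec.choose_spec

variable (J : Type w) [LinearOrder J] [OrderBot J] [SuccOrder J] [WellFoundedLT J]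

variable (c) {J} in
-- The point is that `Q` is chosen before `Z` and `X`: the objects `Z` need not form an essentially
-- small class.
lemma exists_essentiallySmall_iterationFunctor_obj (P : ObjectProperty K)
    [ObjectProperty.EssentiallySmall.{w} P] (j : J) :
    ∃ Q : ObjectProperty K, ObjectProperty.EssentiallySmall.{w} Q ∧
      Q.IsClosedUnderIsomorphisms ∧
      ∀ (Z : K) (hZ : coneInjectives c Z) (X : Over Z), P X.left →
        Q (((succStruct hZ X).iterationFunctor J).obj j).left := by
  induction j using SuccOrder.limitRecOn with
  | isMin j hj =>
    obtain rfl := hj.eq_bot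
    exact ⟨P.isoClosure, inferInstance, inferInstance, fun Z hZ X hX ↦
      ⟨_, hX, ⟨(Over.forget Z).mapIso ((succStruct hZ X).iterationFunctorObjBotIso J)⟩⟩⟩
  | succ j hj ih =>
    obtain ⟨Q, _, _, hQ⟩ := ih
    obtain ⟨R, hR₀, hR₁, hR⟩ := exists_essentiallySmall_attach c Q
    exact ⟨R, hR₀, hR₁, fun Z hZ X hX ↦ R.prop_of_iso
      ((Over.forget Z).mapIso ((succStruct hZ X).iterationFunctorObjSuccIso j hj)).symm
      (hR _ (hQ Z hZ X hX) _)⟩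
  | isSuccLimit j hj ih =>
    choose Q hQ₀ _ hQ using fun i : Set.Iio j ↦ ih i.1 i.2
    obtain ⟨κ, hκ, h⟩ := HasCardinalLT.exists_regular_cardinal.{w} (Arrow (Set.Iio j))
    have := (⨆ i, Q i).isClosedUnderColimitsOfShape_colimitsCardinalClosure κ _ h
    refine ⟨(⨆ i, Q i).colimitsCardinalClosure κ, inferInstance, inferInstance,
      fun Z hZ X hX ↦ ?_⟩
    refine ObjectProperty.prop_of_isColimit _ (isColimitOfPreserves (Over.forget Z)
      (((succStruct hZ X).iterationFunctor J).isColimitOfIsWellOrderContinuous j hj)) fun i ↦ ?_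
    refine ObjectProperty.le_colimitsCardinalClosure _ _ _ ?_
    simp only [iSup_apply, iSup_Prop_eq]
    exact ⟨i, hQ i Z hZ X hX⟩

variable (c) in
lemma exists_essentiallySmall_iteration (P : ObjectProperty K)
    [ObjectProperty.EssentiallySmall.{w} P] :
    ∃ Q : ObjectProperty K, ObjectProperty.EssentiallySmall.{w} Q ∧
      ∀ (Z : K) (hZ : coneInjectives c Z) (X : Over Z), P X.left →
        Q ((succStruct hZ X).iteration J).left := by
  choose Q hQ₀ _ hQ using fun j : J ↦ exists_essentiallySmall_iterationFunctor_obj c P j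
  obtain ⟨κ, hκ, h⟩ := HasCardinalLT.exists_regular_cardinal.{w} (Arrow J)
  have := (⨆ i, Q i).isClosedUnderColimitsOfShape_colimitsCardinalClosure κ _ h
  refine ⟨(⨆ i, Q i).colimitsCardinalClosure κ, inferInstance, fun Z hZ X hX ↦ ?_⟩
  refine ObjectProperty.prop_of_isColimit _ (isColimitOfPreserves (Over.forget Z)
    ((succStruct hZ X).isColimitIterationCocone J)) fun i ↦ ?_
  refine ObjectProperty.le_colimitsCardinalClosure _ _ _ ?_
  simp only [iSup_apply, iSup_Prop_eq]
  exact ⟨i, hQ i Z hZ X hX⟩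

lemma llp_ιIteration_left (T : MorphismProperty K) (hc : ∀ s i, T.llp ((c s).map i))
    {Z : K} (hZ : coneInjectives c Z) (X : Over Z) :
    T.llp ((succStruct hZ X).ιIteration J).left := by
  have : PreservesWellOrderContinuousOfShape J (Over.forget Z) := ⟨fun _ _ ↦ inferInstance⟩
  refine MorphismProperty.transfiniteCompositionsOfShape_le T.llp J _
    (MorphismProperty.transfiniteCompositionsOfShape_map_of_preserves J (Over.forget Z) _
      ⟨((succStruct hZ X).transfiniteCompositionOfShapeιIteration J).ofLE ?_⟩)
  rintro _ _ _ ⟨Y⟩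
  exact llp_toAttach T hc _

/-- By presentability, a map from a cone source to the colimit factors through a stage `j`. There it
is one of the cells, so it extends along a cone member at stage `j + 1`. -/
lemma coneInjectives_iteration (κ : Cardinal.{w}) [Fact κ.IsRegular] [OrderBot κ.ord.ToType]
    [∀ s, IsCardinalPresentable (c s).source κ] {Z : K} (hZ : coneInjectives c Z) (X : Over Z) :
    coneInjectives c ((succStruct hZ X).iteration κ.ord.ToType).left := by
  intro s f
  -- Guarantees that `Order.succ j` is a genuinely later stage.
  have := Cardinal.noMaxOrder (Cardinal.IsRegular.aleph0_le (Fact.out : κ.IsRegular))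
  obtain ⟨j, h, rfl⟩ := IsCardinalPresentable.exists_hom_of_isColimit κ
    (isColimitOfPreserves (Over.forget Z)
      ((succStruct hZ X).isColimitIterationCocone κ.ord.ToType)) f
  obtain ⟨d, rfl⟩ := Cells.exists_hom_eq (c := c) s h
  obtain ⟨g, hg⟩ := exists_map_comp_eq_hom_comp_toAttach
    (exists_toAttach_comp_eq_of_coneInjectives hZ
      (((succStruct hZ X).iterationFunctor κ.ord.ToType).obj j)).choose ⟨s, d⟩
  refine ⟨_, g ≫ ((succStruct hZ X).iterationFunctorObjSuccIso j (not_isMax j)).inv.left ≫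
    (((succStruct hZ X).iterationCocone κ.ord.ToType).ι.app (Order.succ j)).left, ?_⟩
  rw [reassoc_of% hg]
  congr 1
  have h₁ := (succStruct hZ X).iterationFunctor_map_succ j (not_isMax j)
  have h₂ := ((succStruct hZ X).iterationCocone κ.ord.ToType).w (homOfLE (Order.le_succ j))
  rw [h₁, Category.assoc] at h₂
  exact congr_arg CommaMorphism.left h₂

variable (c) in
/-- Maps into cone-injective objects factor through a cone-injective object which is attached by
cells and which belongs to an essentially small class depending on the source only. -/
lemma exists_essentiallySmall_factorization [∀ s, IsPresentable.{w} (c s).source]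
    (T : MorphismProperty K) (hc : ∀ s i, T.llp ((c s).map i))
    (P : ObjectProperty K) [ObjectProperty.EssentiallySmall.{w} P] :
    ∃ Q : ObjectProperty K, ObjectProperty.EssentiallySmall.{w} Q ∧
      ∀ {X Z : K} (f : X ⟶ Z), P X → coneInjectives c Z →
        ∃ (X' : K) (a : X ⟶ X') (b : X' ⟶ Z),
          Q X' ∧ coneInjectives c X' ∧ T.llp a ∧ a ≫ b = f := by
  obtain ⟨κ, hκ, _⟩ := exists_isCardinalPresentable_forall.{w} (fun s ↦ (c s).source)
  have : Nonempty κ.ord.ToType := by simpa using hκ.out.ne_zero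
  let : OrderBot κ.ord.ToType := WellFoundedLT.toOrderBot κ.ord.ToType
  obtain ⟨Q, _, hQ⟩ := exists_essentiallySmall_iteration c κ.ord.ToType P
  exact ⟨Q, inferInstance, fun f hX hZ ↦ ⟨_, _, _, hQ _ hZ (Over.mk f) hX,
    coneInjectives_iteration κ hZ _, llp_ιIteration_left κ.ord.ToType T hc hZ _,
    Over.w ((succStruct hZ (Over.mk f)).ιIteration κ.ord.ToType)⟩⟩

end ConeOfMaps

/-! ### Restriction of the weak factorization system. -/

namespace ConeOfMaps

variable {K : Type u} [Category.{v} K]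

lemma rlp_map_ι_of_factorization (I : MorphismProperty K) (A P Q₁ Q₂ : ObjectProperty K)
    [HasPushouts K]
    (h₁ : ∀ {X Z : K} (f : X ⟶ Z), P X → A Z → ∃ (X' : K) (a : X ⟶ X') (b : X' ⟶ Z),
      Q₁ X' ∧ A X' ∧ cofMaps I a ∧ a ≫ b = f)
    (h₂ : ∀ {X₀ Y₀ X' Z : K} (f : X₀ ⟶ Y₀) (a : X₀ ⟶ X') (z : pushout f a ⟶ Z), I f → Q₁ X' → A Z →
      ∃ (Y' : K) (b : pushout f a ⟶ Y') (y : Y' ⟶ Z), Q₂ Y' ∧ A Y' ∧ cofMaps I b ∧ b ≫ y = z)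
    (hP : ∀ {X Y : K} (f : X ⟶ Y), I f → P X)
    {X Y : A.FullSubcategory} (p : X ⟶ Y)
    (hp : ∀ {X' Y' : A.FullSubcategory} (g : X' ⟶ Y'), Q₁ X'.obj → Q₂ Y'.obj →
      cofMaps I (A.ι.map g) → HasLiftingProperty g p) :
    I.rlp (A.ι.map p) := by
  intro X₀ Y₀ f hf
  refine ⟨fun {t b} sq ↦ ?_⟩
  obtain ⟨X', a, x, hX', hAX', ha, rfl⟩ := h₁ t (hP f hf) X.property
  obtain ⟨Y', q, y, hY', hAY', hq, hy⟩ := h₂ f a (pushout.desc b (x ≫ A.ι.map p)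
    (by simpa using sq.w.symm)) hf hX' Y.property
  have hyl : pushout.inl f a ≫ q ≫ y = b := by rw [hy]; exact pushout.inl_desc _ _ _
  have hyr : pushout.inr f a ≫ q ≫ y = x ≫ p.hom := by rw [hy]; exact pushout.inr_desc _ _ _
  let g : (⟨X', hAX'⟩ : A.FullSubcategory) ⟶ ⟨Y', hAY'⟩ :=
    ObjectProperty.homMk (pushout.inr f a ≫ q)
  -- A cobase change of `f` followed by `q`.
  have hg : cofMaps I (A.ι.map g) := MorphismProperty.comp_mem _ _ _
    (MorphismProperty.of_isPushout (IsPushout.of_hasPushout f a).flip (I.le_llp_rlp _ hf)) hq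
  have := hp g hX' hY' hg
  have sq' : CommSq (ObjectProperty.homMk x : ⟨X', hAX'⟩ ⟶ X) g p
      (ObjectProperty.homMk y : ⟨Y', hAY'⟩ ⟶ Y) := ⟨by
    ext
    simp [g, hyr]⟩
  have fac₁ : (pushout.inr f a ≫ q) ≫ sq'.lift.hom = x :=
    congr_arg InducedCategory.Hom.hom sq'.fac_left
  have fac₂ : sq'.lift.hom ≫ p.hom = y := congr_arg InducedCategory.Hom.hom sq'.fac_right
  exact ⟨⟨{
    l := pushout.inl f a ≫ q ≫ sq'.lift.hom
    fac_left := by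
      rw [pushout.condition_assoc, ← Category.assoc (pushout.inr f a), fac₁]
    fac_right := by
      simp [fac₂, hyl] }⟩⟩

end ConeOfMaps

/-- `J` consists of all maps of `W` between chosen representatives of the objects in both `R` and
`A`; local smallness makes it small. -/
lemma exists_isSmall_forall_hasLiftingProperty {K : Type u} [Category.{v} K] [LocallySmall.{w} K]
    (A R : ObjectProperty K) [ObjectProperty.EssentiallySmall.{w} R] (W : MorphismProperty K)
    [W.RespectsIso] :
    ∃ J : MorphismProperty A.FullSubcategory, MorphismProperty.IsSmall.{w} J ∧
      J ≤ W.inverseImage A.ι ∧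
      ∀ {X Y X' Y' : A.FullSubcategory} (p : X ⟶ Y) (g : X' ⟶ Y'), J.rlp p →
        R X'.obj → R Y'.obj → W (A.ι.map g) → HasLiftingProperty g p := by
  have : ObjectProperty.EssentiallySmall.{w} (R ⊓ A) := .of_le (Q := R) inf_le_left
  obtain ⟨S, _, hS, hS'⟩ := ObjectProperty.EssentiallySmall.exists_small_le.{w} (R ⊓ A)
  let o (X : Subtype S) : A.FullSubcategory := ⟨X.1, (hS _ X.2).2⟩
  refine ⟨.ofHoms (fun x : Σ X Y : Subtype S, { g : o X ⟶ o Y // W (A.ι.map g) } ↦ x.2.2.1),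
    inferInstance, ?_, fun {X Y X' Y'} p g hp hX' hY' hg ↦ ?_⟩
  · rintro _ _ _ ⟨x⟩
    exact x.2.2.2
  · obtain ⟨X'', hX'', ⟨e⟩⟩ := hS' _ ⟨hX', X'.property⟩
    obtain ⟨Y'', hY'', ⟨e'⟩⟩ := hS' _ ⟨hY', Y'.property⟩
    let e₁ : X' ≅ o ⟨X'', hX''⟩ := A.isoMk e
    let e₂ : Y' ≅ o ⟨Y'', hY''⟩ := A.isoMk e'
    let φ : Arrow.mk (e₁.inv ≫ g ≫ e₂.hom) ≅ Arrow.mk g := Arrow.isoMk e₁.symm e₂.symm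
    have : HasLiftingProperty (e₁.inv ≫ g ≫ e₂.hom) p := by
      refine hp _ ⟨(⟨⟨X'', hX''⟩, ⟨Y'', hY''⟩, ⟨e₁.inv ≫ g ≫ e₂.hom, ?_⟩⟩ :
        Σ X Y : Subtype S, { g : o X ⟶ o Y // W (A.ι.map g) })⟩
      exact (W.arrow_mk_iso_iff (A.ι.mapArrow.mapIso φ)).2 hg
    exact HasLiftingProperty.of_arrow_iso_left φ p

theorem mainTheorem8 {K : Type u} [Category.{v} K] [IsLocallyPresentable.{w} K]
    (I : MorphismProperty K) [MorphismProperty.IsSmall.{w} I]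
    (A : ObjectProperty K) [Coreflective A.ι]
    {σ : Type w} (c : σ → ConeOfMaps.{w} K) (hA : A = coneInjectives c)
    (hc : ∀ (s : σ) (i : (c s).ι), cofMaps I ((c s).map i)) :
    ∃ J : MorphismProperty A.FullSubcategory,
      MorphismProperty.IsSmall.{w} J ∧
      (cofMaps I).inverseImage A.ι = cofMaps J ∧
      MorphismProperty.IsWeakFactorizationSystem (cofMaps J) (injMaps J) := by
  obtain ⟨κ, _, _⟩ := IsLocallyPresentable.exists_cardinal.{w} K
  have := hasFiniteColimits_of_hasColimitsOfSize.{w, w} K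
  obtain ⟨ι, X₀, Y₀, f, hI⟩ := (MorphismProperty.isSmall_iff_eq_ofHoms.{w} I).1 inferInstance
  obtain ⟨Q₁, _, hQ₁⟩ :=
    ConeOfMaps.exists_essentiallySmall_factorization c I.rlp hc (.ofObj X₀)
  -- `P` must contain the pushouts of the maps of `I` along maps to objects of `Q₁`, the sources of
  -- the second factorization.
  let P := (.ofObj X₀ ⊔ .ofObj Y₀ ⊔ Q₁ : ObjectProperty K).colimitsCardinalClosure κ
  have hP := (.ofObj X₀ ⊔ .ofObj Y₀ ⊔ Q₁ : ObjectProperty K).le_colimitsCardinalClosure κ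
  have : P.IsClosedUnderColimitsOfShape WalkingSpan :=
    ObjectProperty.isClosedUnderColimitsOfShape_colimitsCardinalClosure _ _ _
      (hasCardinalLT_of_finite _ _ (Cardinal.IsRegular.aleph0_le Fact.out))
  obtain ⟨Q₂, _, hQ₂⟩ := ConeOfMaps.exists_essentiallySmall_factorization c I.rlp hc P
  obtain ⟨J, hJ, hJI, hJR⟩ := exists_isSmall_forall_hasLiftingProperty A (Q₁ ⊔ Q₂) (cofMaps I)
  have h_inj {X Y : A.FullSubcategory} (p : X ⟶ Y) (hp : J.rlp p) : I.rlp (A.ι.map p) := by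
    subst hA
    refine ConeOfMaps.rlp_map_ι_of_factorization I _ (.ofObj X₀) Q₁ Q₂ hQ₁ ?_ ?_ p
      (fun g h h' ↦ hJR p g hp (.inl h) (.inr h'))
    · intro X Y X' Z g a z hg hX' hZ
      refine hQ₂ z ?_ hZ
      rw [hI] at hg
      obtain ⟨i⟩ := hg
      refine ObjectProperty.prop_colimit _ _ ?_
      rintro (_ | _ | _)
      · exact hP _ (.inl (.inl ⟨i⟩))
      · exact hP _ (.inl (.inr ⟨i⟩))
      · exact hP _ (.inr hX')
    · intro X Y g hg
      rw [hI] at hg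
      obtain ⟨i⟩ := hg
      exact ⟨i⟩
  have : HasColimitsOfSize.{w, w} A.FullSubcategory := hasColimits_of_coreflective A.ι
  have : HasPushouts A.FullSubcategory := hasColimitsOfShape_of_coreflective A.ι
  let adj := coreflectorAdjunction A.ι
  have : PreservesColimitsOfSize.{w, w} A.ι := adj.leftAdjoint_preservesColimits
  have (X : A.FullSubcategory) : IsPresentable.{w} X := A.fullyFaithfulι.isPresentable X
  have := hasSmallObjectArgument_of_isPresentable.{w} J
  refine ⟨J, hJ, le_antisymm ?_ ?_, ⟨J.rlp_llp_rlp, rfl, inferInstance⟩⟩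
  · intro X Y g hg Z T p hp
    have := hg _ (h_inj p hp)
    exact A.fullyFaithfulι.hasLiftingProperty g p
  · intro X Y g hg Z T p hp
    -- `p` need not lie in A, so `g` is tested against its coreflection, which is in inj_A(J)
    -- because J ⊂ cof_K(I).
    rw [adj.hasLiftingProperty_iff]
    refine hg _ fun _ _ j hj ↦ ?_
    rw [← adj.hasLiftingProperty_iff]
    exact hJI _ hj _ hp
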